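/- Let $q$ be a power of the prime $p$, let $\mathcal M$ be a multiset of points of $\mathrm{AG}(2,q)$, and let $\lambda$ be an integer with $0<\lambda\le (q-1)/2$. A direction $(d)$ (a point of the line at infinity, i.e. one of the $q+1$ parallel classes of lines) is called $(q-\lambda)$-uniform if at least $q-\lambda$ affine lines with direction $(d)$ meet $\mathcal M$, counted with multiplicity, in the same number $m_d$ of points modulo $p$, and sharply $(q-\lambda)$-uniform if exactly $q-\lambda$ lines with direction $(d)$ do so. The number $m_d$ is unique modulo $p$ because $\lambda\le(q-1)/2$; the lines with direction $(d)$ that do not meet $\mathcal M$ in $m_d$ points modulo $p$ are called renitent. Let $\mathcal E_\lambda$ be a set of $(q-\lambda)$-uniform directions with $|\mathcal E_\lambda|\le q$ that contains at least one sharply $(q-\lambda)$-uniform direction, and for $(d)\in\mathcal E_\lambda$ let $\lambda_d$ be the number of renitent lines with direction $(d)$. Then there are at least $\lambda(|\mathcal E_\lambda|+1-\lambda)$ renitent lines with direction in $\mathcal E_\lambda$. Hence $$\sum_{(d)\in\mathcal E_\lambda}(\lambda-\lambda_d)\le\lambda^2-\lambda ,$$ that is, counted with multiplicity $\lambda-\lambda_d$,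 at most $\lambda^2-\lambda$ directions of $\mathcal E_\lambda$ are incident with fewer than $\lambda$ renitent lines; in particular at most $\lambda^2-\lambda$ directions of $\mathcal E_\lambda$ are incident with fewer than $\lambda$ renitent lines. -/

import Mathlib

open scoped LinearAlgebra.Projectivization

namespace RenitentLines

variable {F : Type*} [Field F]

/-- A direction of the affine plane `AG(2, F) = F × F`: a point of the line at infinity, i.e. a
one-dimensional subspace of `F × F`. The vertical direction is included, so there are `|F| + 1`
directions when `F` is finite. -/
abbrev Direction (F : Type*) [Field F] : Type _ := ℙ F (F × F)

/-- The parallel class of all affine lines of `F × F` with direction `d`. -/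
def parallelClass (d : Direction F) : Set (AffineSubspace F (F × F)) :=
  {l | (l : Set (F × F)).Nonempty ∧ l.direction = d.submodule}

open Classical in
/-- The number of points of the multiset `M` on the line `l`, counted with multiplicity. -/
noncomputable def inter (M : Multiset (F × F)) (l : AffineSubspace F (F × F)) : ℕ :=
  M.countP (fun P => P ∈ l)

/-- The lines with direction `d` that meet `M` in `m` points modulo `p`. -/
def linesMeeting (p : ℕ) (M : Multiset (F × F)) (d : Direction F) (m : ℕ) :
    Set (AffineSubspace F (F × F)) :=
  {l | l ∈ parallelClass d ∧ inter M l ≡ m [MOD p]}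

/-- `m` is a typical intersection number for `N`-uniformity at `d`: at least `N` lines with
direction `d` meet `M` in `m` points modulo `p`. If `2 * N > |F|`, it is unique modulo `p`. -/
def IsTypical (p : ℕ) (M : Multiset (F × F)) (N : ℕ) (d : Direction F) (m : ℕ) : Prop :=
  N ≤ (linesMeeting p M d m).ncard

/-- The direction `d` is `N`-uniform: at least `N` lines with direction `d` meet `M` in the same
number of points modulo `p`. -/
def IsUniform (p : ℕ) (M : Multiset (F × F)) (N : ℕ) (d : Direction F) : Prop :=
  ∃ m, IsTypical p M N d m

/-- The direction `d` is sharply `N`-uniform: exactly `N` lines with direction `d` meet `M` in the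
same number of points modulo `p`. -/
def IsSharplyUniform (p : ℕ) (M : Multiset (F × F)) (N : ℕ) (d : Direction F) : Prop :=
  ∃ m, (linesMeeting p M d m).ncard = N

/-- The renitent lines at the (`N`-uniform) direction `d`: the lines with direction `d` whose
intersection number with `M` is not congruent to the typical intersection number at `d`. -/
def renitentLines (p : ℕ) (M : Multiset (F × F)) (N : ℕ) (d : Direction F) :
    Set (AffineSubspace F (F × F)) :=
  {l | l ∈ parallelClass d ∧ ∃ m, IsTypical p M N d m ∧ ¬ inter M l ≡ m [MOD p]}

end RenitentLines

/-! Since |E| ≤ q, some direction (v) lies outside E, so every direction of E is spanned by w + y•v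
for a unique slope y, where `area v w = 1`. The lines of that class are indexed by c = `area (w + y
• v) P`. Let r_y(c) be the intersection number minus the typical one, in F: its support is the set
of renitent lines. For k < q - 1 the power sum ∑ c^k r_y(c) does not see the typical number and
equals ∑_{P ∈ M} (`area w P` + y `area v P`)^k, a polynomial in y of degree at most k. The λ × λ
Hankel determinant of these polynomials has degree at most λ(λ-1). At a slope y the Hankel matrix
factors as Vandermonde · diagonal · Vandermonde, so its rank is at most λ_d and the determinant
vanishes there to order at least λ - λ_d. At a sharp direction it is nonzero. Counting roots with
multiplicity gives the bound. -/

namespace RenitentLines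

/-! ### Hankel determinants of power sums -/

section Hankel

open Polynomial Matrix

/-- If a polynomial matrix drops rank by `k` at `y`, its determinant has a zero of order at least
`k` at `y`. -/
theorem pow_card_sub_rank_dvd_det {K n : Type*} [Field K] [Fintype n] [DecidableEq n]
    (A : Matrix n n K[X]) (y : K) :
    (X - C y) ^ (Fintype.card n - (A.map (eval y)).rank) ∣ A.det := by
  classical
  obtain ⟨L, L', D, h⟩ :=
    Matrix.Pivot.exists_list_transvec_mul_mul_list_transvec_eq_diagonal (A.map (eval y))
  set S := (L.map TransvectionStruct.toMatrix).prod with hS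
  set T := (L'.map TransvectionStruct.toMatrix).prod with hT
  have hSdet : S.det = 1 := TransvectionStruct.det_toMatrix_prod L
  have hTdet : T.det = 1 := TransvectionStruct.det_toMatrix_prod L'
  have hrank : (A.map (eval y)).rank = Fintype.card {i // D i ≠ 0} := by
    rw [← rank_diagonal, ← h, rank_mul_eq_left_of_isUnit_det _ _ (by simp [hTdet]),
      rank_mul_eq_right_of_isUnit_det _ _ (by simp [hSdet])]
  have hcard : Fintype.card n - (A.map (eval y)).rank = Fintype.card {i // D i = 0} := by
    rw [hrank, Fintype.card_subtype_compl]
    have := Fintype.card_subtype_le (fun i => D i = 0)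
    omega
  set B := S.map C * A * T.map C with hB
  have hdet : B.det = A.det := by
    have h1 : (S.map C).det = C S.det := (RingHom.map_det C S).symm
    have h2 : (T.map C).det = C T.det := (RingHom.map_det C T).symm
    rw [hB, det_mul, det_mul, h1, h2, hSdet, hTdet]
    simp
  have hBeval : B.map (eval y) = diagonal D := by
    have hC : ∀ U : Matrix n n K, (U.map C).map (eval y) = U := fun U => by ext; simp
    have h1 := (evalRingHom y).mapMatrix.map_mul (S.map C * A) (T.map C)
    rw [map_mul _ (S.map C) A] at h1
    simp only [RingHom.mapMatrix_apply, coe_evalRingHom, hC] at h1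
    rw [hB, h1, h]
  -- Each zero of the diagonal form makes a whole row of `B` vanish at `y`.
  have hrow : ∀ i j, D i = 0 → X - C y ∣ B i j := by
    intro i j hi
    rw [dvd_iff_isRoot, IsRoot]
    have := congrFun (congrFun hBeval i) j
    rw [Matrix.map_apply] at this
    rw [this]
    by_cases hij : i = j
    · subst hij; simpa using hi
    · simp [hij]
  -- After transposing, every term of the expansion takes one entry from each row `i`, indexed by
  -- `i` itself.
  rw [hcard, ← hdet, ← det_transpose, det_apply]
  refine Finset.dvd_sum fun σ _ => ?_
  rw [Units.smul_def, zsmul_eq_mul]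
  refine Dvd.dvd.mul_left ?_ _
  have : (X - C y) ^ Fintype.card {i // D i = 0} =
      ∏ i, if D i = 0 then X - C y else (1 : K[X]) := by
    rw [Finset.prod_ite]
    simp [Fintype.card_subtype]
  rw [this]
  refine Finset.prod_dvd_prod_of_dvd _ _ fun i _ => ?_
  split_ifs with hi
  · exact hrow i _ hi
  · exact one_dvd _

/-- The Hankel matrix of the weighted power sums of a function `r`. -/
theorem hankel_eq_mul {K ι : Type*} [Field K] [Fintype ι] [DecidableEq ι] (n : ℕ) (x r : ι → K) :
    (of fun i j : Fin n => ∑ c, x c ^ (i + j : ℕ) * r c) =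
      (of fun (i : Fin n) c => x c ^ (i : ℕ)) * diagonal r *
        (of fun c (j : Fin n) => x c ^ (j : ℕ)) := by
  ext i j
  rw [mul_apply]
  simp only [mul_diagonal, of_apply]
  exact Finset.sum_congr rfl fun c _ => by ring

theorem rank_hankel_le {K : Type*} [Field K] [Fintype K] [DecidableEq K] (n : ℕ) (r : K → K) :
    (of fun i j : Fin n => ∑ c, c ^ (i + j : ℕ) * r c).rank ≤
      (Finset.univ.filter fun c => r c ≠ 0).card := by
  rw [show (of fun i j : Fin n => ∑ c, c ^ (i + j : ℕ) * r c) = _ from hankel_eq_mul n id r]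
  refine (rank_mul_le_left _ _).trans ((rank_mul_le_right _ _).trans ?_)
  rw [rank_diagonal, Fintype.card_subtype]

/-- Restricted to the support, the outer factors are square Vandermonde matrices with distinct nodes
and the diagonal has no zeros. -/
theorem det_hankel_ne_zero {K : Type*} [Field K] [Fintype K] [DecidableEq K] (n : ℕ) (r : K → K)
    (hn : (Finset.univ.filter fun c => r c ≠ 0).card = n) :
    (of fun i j : Fin n => ∑ c, c ^ (i + j : ℕ) * r c).det ≠ 0 := by
  set s := Finset.univ.filter fun c => r c ≠ 0 with hs
  let e : Fin n ≃ s := (s.equivFinOfCardEq hn).symm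
  have hsum : ∀ k : ℕ, ∑ c, c ^ k * r c = ∑ i : Fin n, (e i : K) ^ k * r (e i) := by
    intro k
    rw [e.sum_comp (fun c : s => (c : K) ^ k * r c), Finset.sum_coe_sort s fun c => c ^ k * r c,
      hs, Finset.sum_filter_of_ne]
    intro c _ hc
    exact right_ne_zero_of_mul hc
  simp only [hsum]
  rw [hankel_eq_mul n (fun i => (e i : K)) (fun i => r (e i)), det_mul, det_mul, det_diagonal]
  have hinj : Function.Injective fun i => (e i : K) := Subtype.val_injective.comp e.injective
  have hv : (of fun (c : Fin n) (j : Fin n) => (e c : K) ^ (j : ℕ)).det ≠ 0 :=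
    det_vandermonde_ne_zero_iff.2 hinj
  have hv' : (of fun (i : Fin n) (c : Fin n) => (e c : K) ^ (i : ℕ)).det ≠ 0 := by
    rw [← det_transpose]
    exact hv
  refine mul_ne_zero (mul_ne_zero hv' (Finset.prod_ne_zero_iff.2 fun i _ => ?_)) hv
  exact (Finset.mem_filter.1 (e i).2).2

/-- Each term has degree at most ∑ (σ i + i) = 2 · n(n-1)/2, whatever the permutation. -/
theorem natDegree_det_hankel_le {K : Type*} [Field K] (n : ℕ) (s : ℕ → K[X])
    (hs : ∀ k, (s k).natDegree ≤ k) :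
    (of fun i j : Fin n => s (i + j)).det.natDegree ≤ n * (n - 1) := by
  rw [det_apply]
  refine natDegree_sum_le_of_forall_le _ _ fun σ _ => ?_
  have h : (∏ i, (of fun i j : Fin n => s (i + j)) (σ i) i).natDegree ≤ n * (n - 1) := by
    refine (natDegree_prod_le _ _).trans ?_
    refine (Finset.sum_le_sum fun i _ => hs ((σ i : ℕ) + i)).trans ?_
    rw [Finset.sum_add_distrib, Equiv.sum_comp σ (fun i : Fin n => (i : ℕ)),
      Fin.sum_univ_eq_sum_range (fun i => i) n, ← mul_two, Finset.sum_range_id_mul_two]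
  rcases Int.units_eq_one_or (Equiv.Perm.sign σ) with h' | h' <;> simpa [h'] using h

/-- If the power sums of a family of functions `r y` on `K` are given by polynomials `s k` in `y`
of degree at most `k`, and some `r y` has support of size exactly `n`, then the total deficiency of
the sizes of the supports is at most `n * (n - 1)`. -/
theorem sum_sub_card_support_le {K : Type*} [Field K] [Fintype K] [DecidableEq K] (n : ℕ)
    (s : ℕ → K[X]) (hs : ∀ k, (s k).natDegree ≤ k) (r : K → K → K) (Y : Finset K)
    (heval : ∀ y ∈ Y, ∀ k, k + 2 ≤ 2 * n → (s k).eval y = ∑ c, c ^ k * r y c)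
    (hsharp : ∃ y ∈ Y, (Finset.univ.filter fun c => r y c ≠ 0).card = n) :
    ∑ y ∈ Y, (n - (Finset.univ.filter fun c => r y c ≠ 0).card) ≤ n * (n - 1) := by
  set A : Matrix (Fin n) (Fin n) K[X] := of fun i j : Fin n => s (i + j) with hA
  have hmap : ∀ y ∈ Y, A.map (eval y) = of fun i j : Fin n => ∑ c, c ^ (i + j : ℕ) * r y c := by
    intro y hy
    ext i j
    simp only [hA, Matrix.map_apply, of_apply]
    exact heval y hy _ (by omega)
  have hne : A.det ≠ 0 := by
    obtain ⟨y, hy, hyn⟩ := hsharp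
    intro h0
    apply det_hankel_ne_zero n (r y) hyn
    rw [← hmap y hy]
    have := RingHom.map_det (evalRingHom y) A
    rw [h0, map_zero] at this
    exact this.symm
  have hroot : ∀ y ∈ Y, n - (Finset.univ.filter fun c => r y c ≠ 0).card ≤
      A.det.roots.count y := by
    intro y hy
    rw [count_roots, le_rootMultiplicity_iff hne]
    refine dvd_trans (pow_dvd_pow _ ?_) (pow_card_sub_rank_dvd_det A y)
    rw [hmap y hy, Fintype.card_fin]
    exact Nat.sub_le_sub_left (rank_hankel_le n (r y)) n
  refine (Finset.sum_le_sum hroot).trans ?_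
  have hcount : ∑ y ∈ Y, A.det.roots.count y ≤ A.det.roots.card := by
    rw [← Multiset.toFinset_sum_count_eq]
    refine Finset.sum_le_sum_of_ne_zero fun y _ h => ?_
    simpa using Multiset.count_ne_zero.1 h
  refine hcount.trans ?_
  exact (card_roots' _).trans (natDegree_det_hankel_le n s hs)

end Hankel

/-! ### Parallel classes, typical numbers and coordinates -/

section Lines

variable {F : Type*} [Field F]

theorem rep_mem_submodule (d : Direction F) : d.rep ∈ d.submodule := by
  rw [Projectivization.submodule_eq]
  exact Submodule.mem_span_singleton_self _

/-- The value of `φ` parametrizes the lines whose direction is the kernel of `φ`. -/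
theorem mem_mk'_smul_iff {d : Direction F} {φ : F × F →ₗ[F] F} (hker : φ.ker = d.submodule)
    {e : F × F} (he : φ e = 1) (c : F) (P : F × F) :
    P ∈ AffineSubspace.mk' (c • e) d.submodule ↔ φ P = c := by
  rw [AffineSubspace.mem_mk', ← hker, LinearMap.mem_ker]
  simp [he, sub_eq_zero]

theorem mk'_smul_injective {d : Direction F} {φ : F × F →ₗ[F] F} (hker : φ.ker = d.submodule)
    {e : F × F} (he : φ e = 1) :
    Function.Injective fun c : F => AffineSubspace.mk' (c • e) d.submodule := by
  intro c c' h
  have h1 : c • e ∈ AffineSubspace.mk' (c' • e) d.submodule := by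
    rw [← show _ = AffineSubspace.mk' (c' • e) d.submodule from h]
    exact AffineSubspace.self_mem_mk' _ _
  simpa [he] using (mem_mk'_smul_iff hker he c' _).1 h1

theorem range_mk'_smul {d : Direction F} {φ : F × F →ₗ[F] F} (hker : φ.ker = d.submodule)
    {e : F × F} (he : φ e = 1) :
    Set.range (fun c : F => AffineSubspace.mk' (c • e) d.submodule) = parallelClass d := by
  ext l
  constructor
  · rintro ⟨c, rfl⟩
    exact ⟨⟨_, AffineSubspace.self_mem_mk' _ _⟩, AffineSubspace.direction_mk' _ _⟩
  · rintro ⟨⟨P, hP⟩, hl⟩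
    refine ⟨φ P, ?_⟩
    refine AffineSubspace.ext_of_direction_eq (by simp [hl]) ⟨P, ?_, hP⟩
    exact (mem_mk'_smul_iff hker he _ _).2 rfl

open Classical in
theorem inter_mk'_smul (M : Multiset (F × F)) {d : Direction F} {φ : F × F →ₗ[F] F}
    (hker : φ.ker = d.submodule) {e : F × F} (he : φ e = 1) (c : F) :
    inter M (AffineSubspace.mk' (c • e) d.submodule) = (M.map φ).count c := by
  rw [inter, Multiset.count, Multiset.countP_map, Multiset.countP_eq_card_filter]
  congr 1
  exact Multiset.filter_congr fun P _ => by rw [mem_mk'_smul_iff hker he, eq_comm]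

theorem ncard_sep_parallelClass {d : Direction F} {φ : F × F →ₗ[F] F}
    (hker : φ.ker = d.submodule) {e : F × F} (he : φ e = 1)
    (Q : AffineSubspace F (F × F) → Prop) :
    {l | l ∈ parallelClass d ∧ Q l}.ncard =
      {c : F | Q (AffineSubspace.mk' (c • e) d.submodule)}.ncard := by
  rw [← Set.ncard_image_of_injective _ (mk'_smul_injective hker he)]
  congr 1
  ext l
  rw [Set.mem_ofPred_eq, ← range_mk'_smul hker he]
  constructor
  · rintro ⟨⟨c, rfl⟩, h⟩
    exact ⟨c, h, rfl⟩
  · rintro ⟨c, h, rfl⟩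
    exact ⟨⟨c, rfl⟩, h⟩

theorem ncard_parallelClass [Fintype F] {d : Direction F} {φ : F × F →ₗ[F] F}
    (hker : φ.ker = d.submodule) {e : F × F} (he : φ e = 1) :
    (parallelClass d).ncard = Fintype.card F := by
  have := ncard_sep_parallelClass hker he (fun _ => True)
  simpa [Set.ncard_univ, Nat.card_eq_fintype_card] using this

theorem parallelClass_disjoint {d d' : Direction F} (h : d ≠ d') :
    Disjoint (parallelClass d) (parallelClass d') := by
  rw [Set.disjoint_left]
  rintro l ⟨_, h1⟩ ⟨_, h2⟩
  exact h (Projectivization.submodule_injective (h1.symm.trans h2))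

theorem finite_parallelClass [Finite F] (d : Direction F) : (parallelClass d).Finite :=
  Set.toFinite _

section Typical

variable [Fintype F] {p : ℕ} {M : Multiset (F × F)} {N : ℕ} {d : Direction F}

/-- Two distinct residues would give disjoint families of at least `N` lines each, more than the
class holds. -/
theorem IsTypical.modEq {m m' : ℕ} (hcls : (parallelClass d).ncard < 2 * N)
    (h : IsTypical p M N d m) (h' : IsTypical p M N d m') : m ≡ m' [MOD p] := by
  by_contra hne
  have hdisj : Disjoint (linesMeeting p M d m) (linesMeeting p M d m') := by
    rw [Set.disjoint_left]
    rintro l ⟨_, h1⟩ ⟨_, h2⟩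
    exact hne (h1.symm.trans h2)
  have hle : (linesMeeting p M d m ∪ linesMeeting p M d m').ncard ≤ (parallelClass d).ncard :=
    Set.ncard_le_ncard (Set.union_subset (fun _ h => h.1) fun _ h => h.1) (finite_parallelClass d)
  rw [Set.ncard_union_eq hdisj (Set.toFinite _) (Set.toFinite _)] at hle
  unfold IsTypical at h h'
  omega

theorem IsTypical.renitentLines_eq {m : ℕ} (hcls : (parallelClass d).ncard < 2 * N)
    (h : IsTypical p M N d m) :
    renitentLines p M N d = {l | l ∈ parallelClass d ∧ ¬ inter M l ≡ m [MOD p]} := by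
  ext l
  refine and_congr_right fun _ => ⟨?_, fun hl => ⟨m, h, hl⟩⟩
  rintro ⟨m', h', hl⟩ hm
  exact hl (hm.trans (h.modEq hcls h'))

theorem IsTypical.ncard_add_ncard {m : ℕ} (hcls : (parallelClass d).ncard < 2 * N)
    (h : IsTypical p M N d m) :
    (linesMeeting p M d m).ncard + (renitentLines p M N d).ncard = (parallelClass d).ncard := by
  have : renitentLines p M N d = parallelClass d \ linesMeeting p M d m := by
    rw [h.renitentLines_eq hcls]
    ext l
    simp only [linesMeeting, Set.mem_ofPred_eq, Set.mem_sdiff]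
    tauto
  rw [this, add_comm]
  exact Set.ncard_sdiff_add_ncard_of_subset (fun _ h => h.1) (finite_parallelClass d)

open Classical in
/-- The renitent lines at a direction are the support of the intersection numbers shifted by the
typical one. -/
theorem IsTypical.ncard_renitentLines [CharP F p] {m : ℕ}
    (hcls : (parallelClass d).ncard < 2 * N) (h : IsTypical p M N d m) {φ : F × F →ₗ[F] F}
    (hker : φ.ker = d.submodule) {e : F × F} (he : φ e = 1) :
    (renitentLines p M N d).ncard =
      (Finset.univ.filter fun c : F => (((M.map φ).count c : ℕ) : F) - m ≠ 0).card := by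
  rw [h.renitentLines_eq hcls, ncard_sep_parallelClass hker he, ← Set.ncard_coe_finset]
  congr 1
  ext c
  simp [inter_mk'_smul M hker he, sub_eq_zero, CharP.cast_eq_iff_mod_eq F p, Nat.ModEq]

end Typical

-- The constant `a` drops out because ∑ c^k = 0 over F for k < q - 1, including k = 0.
open Classical in
theorem sum_pow_mul_count_sub [Fintype F] (S : Multiset F) (a : F) {k : ℕ}
    (hk : k < Fintype.card F - 1) :
    ∑ c : F, c ^ k * ((S.count c : F) - a) = (S.map (· ^ k)).sum := by
  simp only [mul_sub, Finset.sum_sub_distrib, ← Finset.sum_mul,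
    FiniteField.sum_pow_lt_card_sub_one F k hk, zero_mul, sub_zero]
  rw [Finset.sum_multiset_map_count]
  rw [← Finset.sum_subset (Finset.subset_univ S.toFinset) fun c _ hc => by
    rw [Multiset.count_eq_zero.2 (by simpa using hc), Nat.cast_zero, mul_zero]]
  exact Finset.sum_congr rfl fun c _ => by rw [nsmul_eq_mul, mul_comm]

/-- The area form `(u, P) ↦ det (u, P)` as a linear functional of `P`. -/
def area (u : F × F) : F × F →ₗ[F] F :=
  u.1 • LinearMap.snd F F F - u.2 • LinearMap.fst F F F

@[simp]
theorem area_apply (u P : F × F) : area u P = u.1 * P.2 - u.2 * P.1 := by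
  simp [area]

theorem ker_area {d : Direction F} {u : F × F} (hu : u ≠ 0) (hd : u ∈ d.submodule) :
    (area u).ker = d.submodule := by
  have hspan : d.submodule = F ∙ u := by
    induction d using Projectivization.ind with
    | h x hx =>
      rw [Projectivization.submodule_mk] at hd ⊢
      obtain ⟨a, rfl⟩ := Submodule.mem_span_singleton.1 hd
      have ha : a ≠ 0 := fun h => hu (by simp [h])
      exact (Submodule.span_singleton_smul_eq (IsUnit.mk0 a ha) x).symm
  rw [hspan]
  ext P
  rw [LinearMap.mem_ker, area_apply, Submodule.mem_span_singleton, sub_eq_zero]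
  constructor
  · intro h
    by_cases h1 : u.1 = 0
    · have h2 : u.2 ≠ 0 := fun h2 => hu (Prod.ext h1 h2)
      refine ⟨P.2 / u.2, Prod.ext ?_ ?_⟩
      · rw [h1, zero_mul] at h
        simpa [h1, h2, eq_comm] using h
      · simp [h2]
    · refine ⟨P.1 / u.1, Prod.ext (by simp [h1]) ?_⟩
      simp only [Prod.smul_snd, smul_eq_mul]
      field_simp
      linear_combination -h
  · rintro ⟨a, rfl⟩
    simp only [Prod.smul_fst, Prod.smul_snd, smul_eq_mul]
    ring

theorem exists_area_eq_one {v : F × F} (hv : v ≠ 0) : ∃ w, area v w = 1 := by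
  by_cases h1 : v.1 = 0
  · have h2 : v.2 ≠ 0 := fun h2 => hv (Prod.ext h1 h2)
    exact ⟨(-v.2⁻¹, 0), by simp [h2]⟩
  · exact ⟨(0, v.1⁻¹), by simp [h1]⟩

/-- All directions except that of `v` have a slope with respect to `v` and `w`. -/
theorem exists_add_smul_mem (v w : F × F) {d : Direction F}
    (hd : v ∉ d.submodule) : ∃ y : F, w + y • v ∈ d.submodule := by
  have hu := d.rep_nonzero
  have hmem := rep_mem_submodule d
  have hne : area v d.rep ≠ 0 := by
    intro h
    apply hd
    rw [← ker_area hu hmem, LinearMap.mem_ker]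
    rw [area_apply] at h ⊢
    linear_combination -h
  refine ⟨area d.rep w / area v d.rep, ?_⟩
  rw [← ker_area hu hmem, LinearMap.mem_ker, map_add, map_smul, smul_eq_mul]
  have : area d.rep v = - area v d.rep := by simp only [area_apply]; ring
  rw [this]
  field_simp
  ring

end Lines

open Polynomial in
/-- The total deficiency of the numbers of renitent lines over the directions of `E`. -/
theorem sum_sub_ncard_renitentLines_le {F : Type*} [Field F] [Fintype F] (p : ℕ) [CharP F p]
    (M : Multiset (F × F)) (lam : ℕ) (hlam : 2 * lam + 1 ≤ Fintype.card F)
    (E : Finset (Direction F)) {v : F × F} (hv : v ≠ 0) (hvE : ∀ d ∈ E, v ∉ d.submodule)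
    (hunif : ∀ d ∈ E, IsUniform p M (Fintype.card F - lam) d)
    (hsharp : ∃ d ∈ E, (renitentLines p M (Fintype.card F - lam) d).ncard = lam) :
    ∑ d ∈ E, (lam - (renitentLines p M (Fintype.card F - lam) d).ncard) ≤ lam * (lam - 1) := by
  classical
  obtain ⟨w, hvw⟩ := exists_area_eq_one hv
  have hslope : ∀ d : Direction F, ∃ y : F, d ∈ E → w + y • v ∈ d.submodule := fun d => by
    by_cases hd : d ∈ E
    · obtain ⟨y, hy⟩ := exists_add_smul_mem v w (hvE d hd)
      exact ⟨y, fun _ => hy⟩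
    · exact ⟨0, fun h => absurd h hd⟩
  choose y hy using hslope
  have harea : ∀ t : F, area (w + t • v) (-v) = 1 := fun t => by
    rw [← hvw]; simp only [area_apply, Prod.fst_add, Prod.snd_add, Prod.smul_fst, Prod.smul_snd,
      Prod.fst_neg, Prod.snd_neg, smul_eq_mul]; ring
  have hne : ∀ t : F, w + t • v ≠ 0 := fun t h => by
    have := harea t
    simp [h] at this
  have hker : ∀ d ∈ E, (area (w + y d • v)).ker = d.submodule := fun d hd =>
    ker_area (hne _) (hy d hd)
  have hinj : Set.InjOn y E := fun d hd d' hd' h => by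
    apply Projectivization.submodule_injective
    rw [← hker d hd, ← hker d' hd', h]
  -- The typical numbers are reindexed by slope, since the Hankel lemma works with slopes.
  have hm : ∃ m : F → ℕ, ∀ d ∈ E, IsTypical p M (Fintype.card F - lam) d (m (y d)) := by
    choose! m hm using hunif
    refine ⟨fun t => m (Function.invFunOn y E t), fun d hd => ?_⟩
    have h : Function.invFunOn y E (y d) = d := hinj.leftInvOn_invFunOn hd
    simp only [h]
    exact hm d hd
  obtain ⟨m, hm⟩ := hm
  have hcls : ∀ d ∈ E, (parallelClass d).ncard < 2 * (Fintype.card F - lam) := fun d hd => by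
    rw [ncard_parallelClass (hker d hd) (harea _)]
    omega
  have hcard := fun d hd => (hm d hd).ncard_renitentLines (hcls d hd) (hker d hd) (harea _)
  have key := sum_sub_card_support_le lam
    (fun k => (M.map fun P => (C (area w P) + X * C (area v P)) ^ k).sum)
    (fun k => by
      refine (natDegree_multiset_sum_le _).trans (Multiset.max_le_of_forall_le _ _ ?_)
      simp only [Multiset.mem_map]
      rintro _ ⟨_, ⟨P, -, rfl⟩, rfl⟩
      refine natDegree_pow_le_of_le k (m := 1) ?_ |>.trans (mul_one k).le
      compute_degree)
    (fun t c => (((M.map (area (w + t • v))).count c : ℕ) : F) - m t) (E.image y)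
    (by
      intro t _ k hk
      -- Here k ≤ 2λ - 2 ≤ q - 3, which is where the bound on λ enters.
      rw [sum_pow_mul_count_sub _ _ (by omega), ← coe_evalRingHom, map_multiset_sum,
        Multiset.map_map, Multiset.map_map]
      congr 1
      refine Multiset.map_congr rfl fun P _ => ?_
      simp
      ring)
    (by
      obtain ⟨d, hd, hdl⟩ := hsharp
      exact ⟨y d, Finset.mem_image_of_mem y hd, (hcard d hd).symm.trans hdl⟩)
  rw [Finset.sum_image hinj] at key
  refine le_trans (Finset.sum_le_sum fun d hd => ?_) key
  rw [hcard d hd]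

end RenitentLines

/-! ### The main theorem -/

open RenitentLines in
theorem theorem4p2 {F : Type*} [Field F] [Fintype F] (p : ℕ) [CharP F p]
    (M : Multiset (F × F)) (lam : ℕ) (hpos : 0 < lam) (hlam : 2 * lam + 1 ≤ Fintype.card F)
    (E : Finset (RenitentLines.Direction F)) (hcard : E.card ≤ Fintype.card F)
    (hunif : ∀ d ∈ E, RenitentLines.IsUniform p M (Fintype.card F - lam) d)
    (hsharp : ∃ d ∈ E, RenitentLines.IsSharplyUniform p M (Fintype.card F - lam) d) :
    (lam : ℤ) * ((E.card : ℤ) + 1 - lam) ≤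
        ((⋃ d ∈ E, RenitentLines.renitentLines p M (Fintype.card F - lam) d).ncard : ℤ) ∧
      ∑ d ∈ E, ((lam : ℤ) -
          ((RenitentLines.renitentLines p M (Fintype.card F - lam) d).ncard : ℤ)) ≤
        (lam : ℤ) ^ 2 - lam ∧
      (({d | d ∈ E ∧ (RenitentLines.renitentLines p M (Fintype.card F - lam) d).ncard < lam} :
          Set (RenitentLines.Direction F)).ncard : ℤ) ≤ (lam : ℤ) ^ 2 - lam := by
  classical
  have hcls : ∀ d : Direction F, (parallelClass d).ncard = Fintype.card F := fun d => by
    obtain ⟨w, hw⟩ := exists_area_eq_one d.rep_nonzero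
    exact ncard_parallelClass (ker_area d.rep_nonzero (rep_mem_submodule d)) hw
  have hcls' : ∀ d : Direction F, (parallelClass d).ncard < 2 * (Fintype.card F - lam) :=
    fun d => by rw [hcls]; omega
  have hle : ∀ d ∈ E, (renitentLines p M (Fintype.card F - lam) d).ncard ≤ lam := fun d hd => by
    obtain ⟨m, hm⟩ := hunif d hd
    have h1 := hm.ncard_add_ncard (hcls' d)
    have h2 : Fintype.card F - lam ≤ _ := hm
    rw [hcls] at h1
    omega
  have hsharp' : ∃ d ∈ E, (renitentLines p M (Fintype.card F - lam) d).ncard = lam := by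
    obtain ⟨d, hd, m, hm⟩ := hsharp
    have h1 := IsTypical.ncard_add_ncard (hcls' d) (show IsTypical p M _ d m from hm.ge)
    rw [hcls, hm] at h1
    exact ⟨d, hd, by omega⟩
  -- There are q + 1 directions, so one is free to play the role of infinite slope.
  obtain ⟨d₀, hd₀⟩ : ∃ d₀ : Direction F, d₀ ∉ E := by
    by_contra! h
    have h1 : Nat.card (Direction F) = _ := Projectivization.card_of_finrank_two F (F × F) (by simp)
    have h2 : E.card = Nat.card (Direction F) := by
      rw [← Set.ncard_univ, ← Set.ncard_coe_finset]
      congr 1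
      exact Set.eq_univ_of_forall h
    rw [Nat.card_eq_fintype_card (α := F)] at h1
    omega
  have hsum := sum_sub_ncard_renitentLines_le p M lam hlam E d₀.rep_nonzero (fun d hd h => by
    have heq : d₀ = d := Projectivization.submodule_injective <|
      (ker_area d₀.rep_nonzero (rep_mem_submodule d₀)).symm.trans (ker_area d₀.rep_nonzero h)
    exact hd₀ (heq ▸ hd)) hunif hsharp'
  have hsumZ : ∑ d ∈ E, ((lam : ℤ) - ((renitentLines p M (Fintype.card F - lam) d).ncard : ℤ)) ≤ (lam : ℤ) ^ 2 - lam := by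
    have h1 : ∑ d ∈ E, ((lam : ℤ) - ((renitentLines p M (Fintype.card F - lam) d).ncard : ℤ)) =
        ((∑ d ∈ E, (lam - (renitentLines p M (Fintype.card F - lam) d).ncard) : ℕ) : ℤ) := by
      rw [Nat.cast_sum]
      exact Finset.sum_congr rfl fun d hd => (Nat.cast_sub (hle d hd)).symm
    have h2 : ((lam * (lam - 1) : ℕ) : ℤ) = (lam : ℤ) ^ 2 - lam := by
      rw [Nat.cast_mul, Nat.cast_sub hpos]; push_cast; ring
    rw [h1, ← h2]
    exact_mod_cast hsum
  refine ⟨?_, hsumZ, ?_⟩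
  · have h1 : (⋃ d ∈ E, renitentLines p M (Fintype.card F - lam) d).ncard = ∑ d ∈ E, (renitentLines p M (Fintype.card F - lam) d).ncard := by
      have := E.finite_toSet.ncard_biUnion
        (s := fun d => renitentLines p M (Fintype.card F - lam) d)
        (fun _ _ => Set.toFinite _)
        (fun d _ d' _ h => (parallelClass_disjoint h).mono (fun _ h => h.1) fun _ h => h.1)
      rwa [finsum_mem_coe_finset] at this
    rw [h1]
    rw [Finset.sum_sub_distrib, Finset.sum_const, nsmul_eq_mul] at hsumZ
    push_cast
    linarith
  · refine le_trans ?_ hsumZ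
    have h1 : {d | d ∈ E ∧ (renitentLines p M (Fintype.card F - lam) d).ncard < lam} = ((E.filter fun d => (renitentLines p M (Fintype.card F - lam) d).ncard < lam) :
        Finset (Direction F)) := by ext; simp
    rw [h1, Set.ncard_coe_finset, Finset.card_filter, Nat.cast_sum]
    -- A deficient direction contributes at least 1 to the sum, any other a nonnegative amount.
    refine Finset.sum_le_sum fun d hd => ?_
    have := hle d hd
    split_ifs <;> push_cast <;> omega
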